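/- Let $p$ be a prime, let $k\ge 1$ and $m\ge 0$ be integers, and let $G$ be a finite group of order $p^{k+2m}(p^k-1)$. Let $N$ be an elementary abelian normal subgroup of $G$ of order $p^k$, let $x$ be a nontrivial element of $N$, and let $C$ be the centralizer of $x$ in $G$. Suppose that $C$ is a Sylow $p$-subgroup of $G$, of order $p^{k+2m}$, and that $N\subseteq [H,H]$ for every subgroup $H$ of $G$ with $N\subseteq H\subseteq C$ and $|H|>p^{k+m}$. Then there exists a simple $\mathbb{C}[G]$-module $V$, of dimension $(p^k-1)p^m$ over $\mathbb{C}$, such that $$\mathbb{C}[G]\;\cong\;\mathbb{C}[G/N]\oplus \operatorname{End}_{\mathbb{C}}V ,$$ where the isomorphism is the canonical map $a\mapsto(\bar a,\ (v\mapsto a v))$ and $\bar a$ is the image of $a$ under $\mathbb{C}[G]\to\mathbb{C}[G/N]$; in particular it is an isomorphism both of $\mathbb{C}$-algebras and of $\mathbb{C}[G]$-modules. -/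

import Mathlib

/-- A subgroup `N` of a group is an elementary abelian `p`-group: its elements commute with
each other and each of them is killed by `p`. -/
def Subgroup.IsElementaryAbelian {G : Type*} [Group G] (p : ℕ) (N : Subgroup G) : Prop :=
  (∀ a ∈ N, ∀ b ∈ N, a * b = b * a) ∧ ∀ a ∈ N, a ^ p = 1

open Module

/-! Choose a simple `V` without nonzero `N`-invariants. Averaging over `N` together with Burnside's
theorem makes the canonical map onto `ℂ[G/N] × End V` surjective, and comparing dimensions gives
`dim V ≤ (p^k - 1) p^m`. Equality would make the map bijective, so only the reverse bound remains.

The index of `C` is `p^k - 1`, so `G` is transitive on `N \ {1}`. The trace on `V` is then constant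
there, and all nontrivial characters of `N` occur in `V` with one multiplicity `d`, so `dim V = (p^k
- 1) d`. The `p`-group `C` fixes some nontrivial `χ` and acts on its weight space, of dimension `d`.
Monomiality gives a line there stable under some `K` with `N ≤ K ≤ C` and index at most `d` in `C`.
Since `[K, K]` fixes this line pointwise while `N` acts on it by `χ ≠ 1`, `hcomm` forces `|K| ≤
p^(k+m)`, hence `d ≥ p^m`. -/

/-! ### Stable lines in representations of nilpotent groups -/

/-- If `ρ a` has eigenvalue `μ` and every conjugate of `ρ a` is a scalar multiple of `ρ a`, then the
`H`-translates of the `μ`-eigenspace are eigenspaces, permuted by the cosets of the centralizer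
of `ρ a`; so the index of the latter is bounded. -/
theorem index_mul_finrank_eigenspace_le {k H W : Type*} [Field k] [Group H] [Finite H]
    [AddCommGroup W] [Module k W] [FiniteDimensional k W] (ρ : H →* End k W) (a : H) (μ : k)
    (hμ : μ ≠ 0)
    (hconj : ∀ h : H, ∃ c : k, ρ (h * a * h⁻¹) = c • ρ a)
    (K : Subgroup H) (hK : ∀ h : H, ρ (h * a * h⁻¹) = ρ a → h ∈ K) :
    K.index * finrank k (End.eigenspace (ρ a) μ) ≤ finrank k W := by
  classical
  choose c hc using hconj
  have hinv : ∀ (h : H) (w : W), ρ h⁻¹ (ρ h w) = w := fun h w ↦ by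
    rw [← Module.End.mul_apply, ← map_mul, inv_mul_cancel, map_one, Module.End.one_apply]
  have hc_inj : ∀ g h : H, c g = c h → g⁻¹ * h ∈ K := fun g h hgh ↦ by
    refine hK _ ?_
    have h1 : ρ (g * a * g⁻¹) = ρ (h * a * h⁻¹) := by rw [hc, hc, hgh]
    calc ρ (g⁻¹ * h * a * (g⁻¹ * h)⁻¹) = ρ g⁻¹ * ρ (h * a * h⁻¹) * ρ g := by
          rw [← map_mul, ← map_mul]; congr 1; group
      _ = ρ a := by rw [← h1, ← map_mul, ← map_mul]; congr 1; group
  let ev : H ⧸ K → k := fun q ↦ c q.out * μ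
  have hev : Function.Injective ev := fun q r hqr ↦ by
    have := hc_inj _ _ (mul_right_cancel₀ hμ hqr)
    rw [← q.out_eq', ← r.out_eq']
    exact QuotientGroup.eq.mpr this
  have hle : ∀ q, finrank k (End.eigenspace (ρ a) μ) ≤ finrank k (End.eigenspace (ρ a) (ev q)) := by
    intro q
    have hmap : ∀ w ∈ End.eigenspace (ρ a) μ, ρ (q.out)⁻¹ w ∈ End.eigenspace (ρ a) (ev q) := by
      intro w hw
      rw [End.mem_eigenspace_iff] at hw ⊢
      calc ρ a (ρ q.out⁻¹ w) = (ρ q.out⁻¹ * ρ (q.out * a * q.out⁻¹)) w := by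
            rw [← Module.End.mul_apply, ← map_mul, ← map_mul]; congr 2; group
        _ = ev q • ρ q.out⁻¹ w := by
            rw [hc, Module.End.mul_apply, LinearMap.smul_apply, hw, smul_smul, map_smul]
    refine LinearMap.finrank_le_finrank_of_injective (f := (ρ q.out⁻¹).restrict hmap) ?_
    intro u v huv
    have := congrArg Subtype.val huv
    simp only [LinearMap.restrict_apply] at this
    have h2 := congrArg (ρ (q.out⁻¹)⁻¹) this
    rwa [hinv, hinv, Subtype.val_inj] at h2
  have hind := (End.eigenspaces_iSupIndep (ρ a)).comp hev
  cases nonempty_fintype (H ⧸ K)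
  have h3 := LinearMap.finrank_le_finrank_of_injective hind.dfinsupp_lsum_injective
  have h4 : finrank k (Π₀ q, End.eigenspace (ρ a) (ev q)) =
      ∑ q, finrank k (End.eigenspace (ρ a) (ev q)) :=
    Module.finrank_directSum k fun q ↦ End.eigenspace (ρ a) (ev q)
  calc K.index * finrank k (End.eigenspace (ρ a) μ)
      = ∑ q : H ⧸ K, finrank k (End.eigenspace (ρ a) μ) := by
        rw [Finset.sum_const, smul_eq_mul, Finset.card_univ, ← Nat.card_eq_fintype_card]; rfl
    _ ≤ _ := Finset.sum_le_sum fun q _ ↦ hle q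
    _ = _ := h4.symm
    _ ≤ _ := h3

/-- The first term of the upper central series outside `Z` is central modulo `Z`. -/
theorem exists_notMem_forall_commutator_mem {H : Type*} [Group H] [Group.IsNilpotent H]
    {Z : Subgroup H} (hZ : Z ≠ ⊤) : ∃ a ∉ Z, ∀ h : H, h * a * h⁻¹ * a⁻¹ ∈ Z := by
  classical
  obtain ⟨n, hn⟩ := Group.IsNilpotent.nilpotent H
  have hex : ∃ n, ¬ Subgroup.upperCentralSeries H n ≤ Z := ⟨n, by rwa [hn, top_le_iff]⟩
  obtain ⟨j, hj⟩ : ∃ j, Nat.find hex = j + 1 := by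
    refine Nat.exists_eq_succ_of_ne_zero fun h0 ↦ Nat.find_spec hex ?_
    rw [h0]; simp
  have h1 := Nat.find_spec hex
  have h2 : Subgroup.upperCentralSeries H j ≤ Z := not_not.mp (Nat.find_min hex (by omega))
  obtain ⟨a, ha, haZ⟩ := SetLike.not_le_iff_exists.mp h1
  rw [hj] at ha
  refine ⟨a, haZ, fun h ↦ ?_⟩
  have h3 := Subgroup.mem_upperCentralSeries_succ_iff.mp ha h
  have h4 := Z.inv_mem (h2 h3)
  convert h4 using 1
  group

/-- A finite-dimensional representation of a finite nilpotent group contains a line which is stable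
under a subgroup of index at most the dimension, and that contains all elements acting as scalars
(a form of the theorem that such representations are monomial). -/
theorem exists_eigenvector_of_isNilpotent {k : Type*} [Field k] [IsAlgClosed k] (n : ℕ) :
    ∀ {H : Type*} [Group H] [Finite H] [Group.IsNilpotent H] {W : Type*} [AddCommGroup W]
      [Module k W] [FiniteDimensional k W] [Nontrivial W] (ρ : H →* End k W), finrank k W ≤ n →
      ∃ (K : Subgroup H) (w : W), w ≠ 0 ∧ (∀ h ∈ K, ∃ c : k, ρ h w = c • w) ∧
        K.index ≤ finrank k W ∧ ∀ h : H, (∃ c : k, ρ h = c • 1) → h ∈ K := by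
  induction n with
  | zero =>
    intro H _ _ _ W _ _ _ _ ρ hW
    have := finrank_pos (R := k) (M := W)
    omega
  | succ n ih =>
    intro H _ _ _ W _ _ _ _ ρ hW
    let Z : Subgroup H :=
      { carrier := {h | ∃ c : k, ρ h = c • 1}
        one_mem' := ⟨1, by simp⟩
        mul_mem' := by
          rintro a b ⟨c, hc⟩ ⟨d, hd⟩
          exact ⟨c * d, by rw [map_mul, hc, hd, smul_mul_smul_comm, one_mul]⟩
        inv_mem' := by
          rintro a ⟨c, hc⟩
          refine ⟨c⁻¹, ?_⟩
          have h1 : ρ a⁻¹ * ρ a = 1 := by rw [← map_mul, inv_mul_cancel, map_one]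
          rw [hc, mul_smul_comm, mul_one] at h1
          have hc0 : c ≠ 0 := by
            rintro rfl
            rw [zero_smul] at h1
            exact zero_ne_one h1
          rw [← h1, smul_smul, inv_mul_cancel₀ hc0, one_smul] }
    by_cases hZ : Z = ⊤
    · obtain ⟨w, hw⟩ := exists_ne (0 : W)
      refine ⟨⊤, w, hw, fun h _ ↦ ?_, ?_, fun _ _ ↦ trivial⟩
      · obtain ⟨c, hc⟩ : h ∈ Z := hZ ▸ trivial
        exact ⟨c, by rw [hc]; simp⟩
      · rw [Subgroup.index_top]
        exact finrank_pos
    -- `ρ a` is not scalar, yet central modulo scalars: its eigenspaces are proper, and induction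
    -- applies to one of them under its stabilizer `K`.
    obtain ⟨a, haZ, ha⟩ := exists_notMem_forall_commutator_mem hZ
    have hconj : ∀ h : H, ∃ c : k, ρ (h * a * h⁻¹) = c • ρ a := fun h ↦ by
      obtain ⟨c, hc⟩ := ha h
      exact ⟨c, by rw [← inv_mul_cancel_right (h * a * h⁻¹) a, map_mul, hc, smul_one_mul]⟩
    obtain ⟨μ, hμ⟩ := End.exists_eigenvalue (ρ a)
    have hμ0 : μ ≠ 0 := by
      rintro rfl
      obtain ⟨v, hv⟩ := hμ.exists_hasEigenvector
      have h1 := hv.apply_eq_smul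
      rw [zero_smul] at h1
      apply hv.2
      rw [← Module.End.one_apply (R := k) v, ← map_one ρ, ← inv_mul_cancel a, map_mul,
        Module.End.mul_apply, h1, map_zero]
    set U := End.eigenspace (ρ a) μ with hU
    let K : Subgroup H :=
      { carrier := {h | ρ (h * a * h⁻¹) = ρ a}
        one_mem' := by simp
        mul_mem' := by
          intro g h hg hh
          simp only [Set.mem_ofPred_eq] at hg hh ⊢
          calc ρ (g * h * a * (g * h)⁻¹) = ρ g * ρ (h * a * h⁻¹) * ρ g⁻¹ := by
                rw [← map_mul, ← map_mul]; congr 1; group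
            _ = ρ a := by rw [hh, ← map_mul, ← map_mul, hg]
        inv_mem' := by
          intro g hg
          simp only [Set.mem_ofPred_eq] at hg ⊢
          calc ρ (g⁻¹ * a * g⁻¹⁻¹) = ρ g⁻¹ * ρ a * ρ g := by
                rw [← map_mul, ← map_mul, inv_inv]
            _ = ρ g⁻¹ * ρ (g * a * g⁻¹) * ρ g := by rw [hg]
            _ = ρ a := by rw [← map_mul, ← map_mul]; congr 1; group }
    have hKmem : ∀ h, h ∈ K ↔ ρ (h * a * h⁻¹) = ρ a := fun h ↦ Iff.rfl
    have hindex := index_mul_finrank_eigenspace_le ρ a μ hμ0 hconj K fun h hh ↦ hh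
    have hstab : ∀ h ∈ K, ∀ w ∈ U, ρ h w ∈ U := by
      intro h hh w hw
      rw [hU, End.mem_eigenspace_iff] at hw ⊢
      rw [hKmem] at hh
      rw [← Module.End.mul_apply, ← hh, ← map_mul, inv_mul_cancel_right, map_mul,
        Module.End.mul_apply, hw, map_smul]
    let σ : K →* End k U :=
      { toFun := fun h ↦ (ρ h).restrict (hstab h h.2)
        map_one' := by ext; simp
        map_mul' := by intros; ext; simp }
    have hσ : ∀ (h : K) (u : U), (σ h u : W) = ρ h u := fun _ _ ↦ rfl
    have hUlt : finrank k U < finrank k W := by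
      refine Submodule.finrank_lt fun htop ↦ haZ ⟨μ, LinearMap.ext fun w ↦ ?_⟩
      have : w ∈ U := htop ▸ trivial
      simpa using End.mem_eigenspace_iff.mp this
    have : Nontrivial U := Submodule.nontrivial_iff_ne_bot.mpr hμ
    obtain ⟨L, u, hu0, hLu, hLidx, hLsc⟩ := ih σ (by omega)
    refine ⟨L.map K.subtype, u, by simpa using hu0, ?_, ?_, ?_⟩
    · rintro _ ⟨h, hh, rfl⟩
      obtain ⟨c, hc⟩ := hLu h hh
      exact ⟨c, by simpa [hσ] using congrArg Subtype.val hc⟩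
    · rw [Subgroup.index_map_subtype, mul_comm]
      exact (Nat.mul_le_mul_left _ hLidx).trans hindex
    · rintro h ⟨c, hc⟩
      have hh : h ∈ K := by
        rw [hKmem, map_mul, map_mul, hc, smul_one_mul, smul_mul_assoc, ← mul_smul_one, mul_assoc,
          ← hc, ← map_mul, inv_mul_cancel, map_one, mul_one]
      refine ⟨⟨h, hh⟩, hLsc _ ⟨c, ?_⟩, rfl⟩
      ext v
      simp [hσ, hc]

/-! ### Burnside's theorem and the bound from commutators -/

/-- **Burnside's theorem** on matrix algebras, for simple modules. -/
theorem lsmul_surjective_of_isSimpleModule (k A V : Type*) [Field k] [IsAlgClosed k] [Ring A]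
    [Algebra k A] [AddCommGroup V] [Module k V] [Module A V] [IsScalarTower k A V]
    [IsSimpleModule A V] [FiniteDimensional k V] :
    Function.Surjective (Algebra.lsmul k k V : A →ₐ[k] End k V) := by
  intro T
  -- By Schur, `End A V` is just `k`, so every `k`-linear map lies in the bicommutant and density
  -- applies.
  let f : End (End A V) V :=
    { T with
      map_smul' := fun g v ↦ by
        obtain ⟨c, rfl⟩ := (IsSimpleModule.algebraMap_end_bijective_of_isAlgClosed k).2 g
        exact map_smul T c v }
  obtain ⟨s, hs⟩ := Module.Finite.fg_top (R := k) (M := V)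
  obtain ⟨r, hr⟩ := jacobson_density f s
  refine ⟨r, LinearMap.ext_on hs fun m hm ↦ ?_⟩
  exact (hr m hm).symm

/-- If every subgroup between `N` and `C` of order more than `b` has `N` in its commutator
subgroup, then a representation of `C` on which `N` acts by a nontrivial scalar character
has dimension at least `|C| / b`. -/
theorem card_le_mul_finrank_of_scalar {k G W : Type*} [Field k] [IsAlgClosed k] [Group G] [Finite G]
    (N C : Subgroup G) [Group.IsNilpotent C] (hNC : N ≤ C) (b : ℕ)
    (hcomm : ∀ H : Subgroup G, N ≤ H → H ≤ C → b < Nat.card H → N ≤ ⁅H, H⁆)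
    [AddCommGroup W] [Module k W] [FiniteDimensional k W] [Nontrivial W] (σ : C →* End k W)
    (hσ : ∀ n : C, (n : G) ∈ N → ∃ c : k, σ n = c • 1)
    (hσ1 : ∃ n : C, (n : G) ∈ N ∧ σ n ≠ 1) :
    Nat.card C ≤ b * finrank k W := by
  obtain ⟨K, w, hw, hKw, hidx, hsc⟩ := exists_eigenvector_of_isNilpotent _ σ le_rfl
  have hcard : Nat.card (K.map C.subtype) = Nat.card K :=
    Subgroup.card_map_of_injective C.subtype_injective
  have hNK : N ≤ K.map C.subtype := fun n hn ↦ ⟨⟨n, hNC hn⟩, hsc _ (hσ _ hn), rfl⟩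
  have hb : Nat.card K ≤ b := by
    by_contra! hlt
    have h1 := hcomm _ hNK (Subgroup.map_subtype_le K) (by rwa [hcard])
    rw [← Subgroup.map_commutator] at h1
    let S : Subgroup C :=
      { carrier := {h | σ h w = w}
        one_mem' := by simp
        mul_mem' := by
          intro g h hg hh
          simp only [Set.mem_ofPred_eq] at hg hh ⊢
          rw [map_mul, End.mul_apply, hh, hg]
        inv_mem' := by
          intro g hg
          simp only [Set.mem_ofPred_eq] at hg ⊢
          conv_lhs => rw [← hg]
          rw [← End.mul_apply, ← map_mul, inv_mul_cancel, map_one, End.one_apply] }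
    have h2 : ⁅K, K⁆ ≤ S := by
      rw [Subgroup.commutator_le]
      intro g hg h hh
      obtain ⟨c, hc⟩ := hKw g hg
      obtain ⟨d, hd⟩ := hKw h hh
      -- Scalars on the line commute, so commutators fix `w`.
      have h3 : σ (g * h) w = σ (h * g) w := by
        simp only [map_mul, End.mul_apply, hc, hd, map_smul, smul_smul, mul_comm]
      have h4 : g * h * g⁻¹ * h⁻¹ = (g * h) * (h * g)⁻¹ := by group
      change σ (g * h * g⁻¹ * h⁻¹) w = w
      obtain ⟨e, he⟩ := hKw _ (K.inv_mem (K.mul_mem hh hg))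
      rw [h4, map_mul, End.mul_apply, he, map_smul, h3, ← map_smul, ← he, ← End.mul_apply,
        ← map_mul, mul_inv_cancel, map_one, End.one_apply]
    obtain ⟨n, hn, hn1⟩ := hσ1
    obtain ⟨n', hn', hnn⟩ := h1 hn
    obtain rfl : n' = n := Subtype.ext hnn
    obtain ⟨c, hc⟩ := hσ n' hn
    have h7 : σ n' w = w := h2 hn'
    rw [hc, LinearMap.smul_apply, End.one_apply] at h7
    have : c = 1 := by
      have : (c - 1) • w = 0 := by rw [sub_smul, h7, one_smul, sub_self]
      exact sub_eq_zero.mp ((smul_eq_zero.mp this).resolve_right hw)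
    exact hn1 (by rw [hc, this, one_smul])
  calc Nat.card C = Nat.card K * K.index := K.card_mul_index.symm
    _ ≤ b * finrank k W := Nat.mul_le_mul hb hidx

/-! ### Characters of `N` and their multiplicities -/

/-- A `p`-group normalizing an abelian group of order divisible by `p` fixes a nontrivial
character of it. -/
theorem exists_ne_one_forall_conj_eq {G : Type*} [Group G] [Finite G] {p : ℕ} [Fact p.Prime]
    (N C : Subgroup G) [N.Normal] (hN : ∀ a ∈ N, ∀ b ∈ N, a * b = b * a) (hp : p ∣ Nat.card N)
    (hC : IsPGroup p C) :
    ∃ χ : N →* ℂˣ, χ ≠ 1 ∧ ∀ c ∈ C, ∀ n : N, χ (MulAut.conjNormal c n) = χ n := by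
  let : CommGroup N := { (inferInstance : Group N) with
    mul_comm := fun a b ↦ Subtype.ext (hN a a.2 b b.2) }
  let : MulAction C (N →* ℂˣ) :=
    { smul := fun c χ ↦ χ.comp (MulAut.conjNormal (c : G)⁻¹).toMonoidHom
      one_smul := fun χ ↦ by
        ext n
        change ((χ (MulAut.conjNormal (((1 : C) : G)⁻¹) n) : ℂˣ) : ℂ) = χ n
        simp
      mul_smul := fun a b χ ↦ by
        ext n
        change ((χ (MulAut.conjNormal (((a * b : C) : G)⁻¹) n) : ℂˣ) : ℂ) =
          χ (MulAut.conjNormal ((b : G)⁻¹) (MulAut.conjNormal ((a : G)⁻¹) n))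
        simp }
  have hsmul : ∀ (c : C) (χ : N →* ℂˣ) (n : N), (c • χ) n = χ (MulAut.conjNormal ((c : G)⁻¹) n) :=
    fun _ _ _ ↦ rfl
  have hcard : Nat.card (N →* ℂˣ) = Nat.card N :=
    have : NeZero (Monoid.exponent N) := ⟨Monoid.exponent_ne_zero_of_finite⟩
    CommGroup.card_monoidHom_of_hasEnoughRootsOfUnity N ℂ
  have : Finite (N →* ℂˣ) := Nat.finite_of_card_ne_zero (hcard ▸ Nat.card_pos.ne')
  -- The trivial character is fixed, and `p` divides the number of characters, so there is a second
  -- fixed point.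
  obtain ⟨χ, hχ, hχ1⟩ := hC.exists_fixed_point_of_prime_dvd_card_of_fixed_point (N →* ℂˣ)
    (hcard ▸ hp) (a := 1) fun c ↦ by ext n; rw [hsmul]; rfl
  refine ⟨χ, hχ1.symm, fun c hc n ↦ ?_⟩
  conv_rhs => rw [← hχ ⟨c⁻¹, C.inv_mem hc⟩, hsmul]
  simp

/-- The subspace of a representation on which the group acts through a character. -/
def weightSpace {k N V : Type*} [Field k] [Group N] [AddCommGroup V] [Module k V]
    (σ : N →* End k V) (χ : N →* kˣ) : Submodule k V where
  carrier := {v | ∀ n, σ n v = (χ n : k) • v}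
  zero_mem' := by simp
  add_mem' := by
    intro u v hu hv n
    rw [map_add, hu, hv, smul_add]
  smul_mem' := by
    intro c v hv n
    rw [map_smul, hv, smul_comm]

section weightSpace

variable {k N V : Type*} [Field k] [Group N] [AddCommGroup V] [Module k V]
  (σ : N →* End k V) (χ : N →* kˣ)

/-- The average of `χ(n)⁻¹ σ(n)` projects onto the weight space, and the trace of a projection is
its rank. -/
theorem card_mul_finrank_weightSpace [CharZero k] [Fintype N] [FiniteDimensional k V] :
    (Fintype.card N : k) * finrank k (weightSpace σ χ) =
      ∑ n, (χ n⁻¹ : k) * LinearMap.trace k V (σ n) := by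
  have h0 : (Fintype.card N : k) ≠ 0 := Nat.cast_ne_zero.mpr Fintype.card_ne_zero
  have hproj : LinearMap.IsProj (weightSpace σ χ)
      ((Fintype.card N : k)⁻¹ • ∑ n, (χ n⁻¹ : k) • σ n) := by
    constructor
    · intro v g
      simp only [LinearMap.smul_apply, LinearMap.sum_apply, map_smul, map_sum]
      rw [smul_comm (χ g : k)]
      congr 1
      rw [Finset.smul_sum, ← Equiv.sum_comp (Equiv.mulLeft g) fun n ↦
        (χ g : k) • (χ n⁻¹ : k) • σ n v]
      refine Finset.sum_congr rfl fun n _ ↦ ?_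
      simp only [Equiv.coe_mulLeft, mul_inv_rev, map_mul, Units.val_mul, End.mul_apply, smul_smul]
      rw [mul_left_comm, ← Units.val_mul (χ g), ← map_mul, mul_inv_cancel, map_one, Units.val_one,
        mul_one]
    · intro v hv
      have h1 : ∀ n, (χ n⁻¹ : k) • σ n v = v := fun n ↦ by
        rw [hv n, smul_smul, ← Units.val_mul, ← map_mul, inv_mul_cancel, map_one, Units.val_one,
          one_smul]
      simp only [LinearMap.smul_apply, LinearMap.sum_apply, h1, Finset.sum_const,
        Finset.card_univ, ← Nat.cast_smul_eq_nsmul k, smul_smul]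
      rw [inv_mul_cancel₀ h0, one_smul]
  have h2 := hproj.trace
  rw [map_smul, map_sum, smul_eq_mul, inv_mul_eq_iff_eq_mul₀ h0] at h2
  rw [← h2]
  simp

/-- If the nonidentity elements all have the same trace and there are no invariants, then all
nontrivial characters have the same multiplicity. -/
theorem finrank_eq_of_trace_eq [CharZero k] [Finite N] [FiniteDimensional k V] (c : k)
    (hc : ∀ n : N, n ≠ 1 → LinearMap.trace k V (σ n) = c)
    (hinv : ∀ v, (∀ n, σ n v = v) → v = 0) (hχ : χ ≠ 1) :
    finrank k V = (Nat.card N - 1) * finrank k (weightSpace σ χ) := by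
  classical
  cases nonempty_fintype N
  have hsum : ∀ ψ : N →* kˣ, ∑ n, (ψ n⁻¹ : k) * LinearMap.trace k V (σ n) =
      -- The trace is the constant `c` plus `dim V - c` at the identity. The trivial character then
      -- gives `dim V = -(|N| - 1) c`, and any other has multiplicity `-c`.
      finrank k V - c + c * ∑ n, (ψ n⁻¹ : k) := fun ψ ↦ by
    have h1 : ∀ n, (ψ n⁻¹ : k) * LinearMap.trace k V (σ n) =
        c * (ψ n⁻¹ : k) + if n = 1 then (finrank k V - c : k) else 0 := by
      intro n
      by_cases hn : n = 1
      · subst hn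
        simp
      · rw [hc n hn, if_neg hn, add_zero, mul_comm]
    simp_rw [h1, Finset.sum_add_distrib, ← Finset.mul_sum]
    simp [add_comm]
  have hbot : weightSpace σ 1 = ⊥ := by
    rw [eq_bot_iff]
    intro v hv
    exact hinv v fun n ↦ by simpa using hv n
  have e1 := card_mul_finrank_weightSpace σ (1 : N →* kˣ)
  have e2 := card_mul_finrank_weightSpace σ χ
  rw [hsum, hbot] at e1
  have h3 : ∑ n, (χ n⁻¹ : k) = 0 := by
    refine (Equiv.sum_comp (Equiv.inv N) fun n ↦ (χ n : k)).trans ?_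
    refine sum_hom_units_eq_zero ((Units.coeHom k).comp χ) fun h ↦ hχ ?_
    ext n
    exact DFunLike.congr_fun h n
  rw [hsum, h3] at e2
  have h0 : (Fintype.card N : k) ≠ 0 := Nat.cast_ne_zero.mpr Fintype.card_ne_zero
  simp only [finrank_bot, Nat.cast_zero, mul_zero, add_zero, MonoidHom.one_apply, Units.val_one,
    Finset.sum_const, Finset.card_univ, nsmul_eq_mul, mul_one] at e1 e2
  have h4 : (finrank k (weightSpace σ χ) : k) = -c := by
    apply mul_left_cancel₀ h0
    linear_combination e2 - e1
  rw [Nat.card_eq_fintype_card, ← Nat.cast_inj (R := k), Nat.cast_mul,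
    Nat.cast_sub Fintype.card_pos, h4]
  push_cast
  linear_combination -e1

end weightSpace

/-- The conjugacy class of `x` lies in `N \ {1}` and is at least as large, so it fills it. -/
theorem exists_conj_eq {G : Type*} [Group G] [Finite G] (N : Subgroup G) [N.Normal] {x : G}
    (hxN : x ∈ N) (hx : x ≠ 1) (hidx : Nat.card N - 1 ≤ (Subgroup.centralizer {x}).index)
    {n : G} (hn : n ∈ N) (hn1 : n ≠ 1) : ∃ g : G, g * x * g⁻¹ = n := by
  have h1 : (MulAction.orbit (ConjAct G) x).ncard = (Subgroup.centralizer {x}).index := by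
    rw [← MulAction.index_stabilizer, ConjAct.stabilizer_eq_centralizer]
    rfl
  have h2 : MulAction.orbit (ConjAct G) x ⊆ (N : Set G) \ {1} := by
    rintro _ ⟨g, rfl⟩
    refine ⟨Subgroup.Normal.conj_mem ‹_› x hxN _, fun h ↦ hx ?_⟩
    simpa [ConjAct.smul_def] using h
  have h3 : ((N : Set G) \ {1}).ncard = Nat.card N - 1 := by
    rw [Set.ncard_sdiff_singleton_of_mem N.one_mem]
    rfl
  have h4 := Set.eq_of_subset_of_ncard_le h2 (by omega)
  have h5 : n ∈ MulAction.orbit (ConjAct G) x := h4 ▸ ⟨hn, hn1⟩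
  obtain ⟨g, hg⟩ := h5
  exact ⟨ConjAct.ofConjAct g, hg⟩

/-! ### The group algebra and its quotient -/

theorem finrank_monoidAlgebra (k G : Type*) [Field k] [Finite G] :
    finrank k (MonoidAlgebra k G) = Nat.card G := by
  cases nonempty_fintype G
  rw [(MonoidAlgebra.coeffLinearEquiv k).finrank_eq, finrank_finsupp_self, Nat.card_eq_fintype_card]

/-- The action of a group on a module over its group algebra. -/
noncomputable def groupAction (k G V : Type*) [Field k] [Group G] [AddCommGroup V] [Module k V]
    [Module (MonoidAlgebra k G) V] [IsScalarTower k (MonoidAlgebra k G) V] : G →* End k V :=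
  ((Algebra.lsmul k k V : MonoidAlgebra k G →ₐ[k] End k V) : MonoidAlgebra k G →* End k V).comp
    (MonoidAlgebra.of k G)

/-- A nontrivial normal subgroup has no invariants on a suitable simple module. -/
theorem exists_isSimpleModule_forall_invariant_eq_zero (k : Type*) {G : Type*} [Field k]
    [CharZero k] [Group G] [Finite G] (N : Subgroup G) [N.Normal] (hN : N ≠ ⊥) :
    ∃ V : Submodule (MonoidAlgebra k G) (MonoidAlgebra k G),
      IsSimpleModule (MonoidAlgebra k G) V ∧
      ∀ v : V, (∀ n ∈ N, MonoidAlgebra.of k G n • v = v) → v = 0 := by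
  have : NeZero (Nat.card G : k) := ⟨Nat.cast_ne_zero.mpr Nat.card_pos.ne'⟩
  -- The `N`-invariants of the regular module, a submodule because `N` is normal; `V` is found
  -- inside a complement.
  let F : Submodule (MonoidAlgebra k G) (MonoidAlgebra k G) :=
    { carrier := {v | ∀ n ∈ N, MonoidAlgebra.of k G n * v = v}
      zero_mem' := by simp
      add_mem' := by
        intro u v hu hv n hn
        rw [mul_add, hu n hn, hv n hn]
      smul_mem' := by
        intro a v hv n hn
        rw [smul_eq_mul]
        induction a using MonoidAlgebra.induction_on with
        | of g =>
          have h1 : MonoidAlgebra.of k G n * MonoidAlgebra.of k G g =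
              MonoidAlgebra.of k G g * MonoidAlgebra.of k G (g⁻¹ * n * g) := by
            rw [← map_mul, ← map_mul]; congr 1; group
          have h2 : g⁻¹ * n * g ∈ N := by
            simpa using Subgroup.Normal.conj_mem ‹_› n hn g⁻¹
          rw [← mul_assoc, h1, mul_assoc, hv _ h2]
        | add a b ha hb => rw [add_mul, mul_add, ha, hb]
        | smul r a ha => rw [smul_mul_assoc, mul_smul_comm, ha] }
  obtain ⟨Q, hQ⟩ := exists_isCompl F
  obtain ⟨⟨x, hx⟩, hx1⟩ := Subgroup.ne_bot_iff_exists_ne_one.mp hN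
  have hF : F ≠ ⊤ := fun h ↦ by
    have h1 : (1 : MonoidAlgebra k G) ∈ F := h ▸ trivial
    have h2 := h1 x hx
    rw [mul_one, ← map_one (MonoidAlgebra.of k G)] at h2
    exact hx1 (Subtype.ext (MonoidAlgebra.of_injective h2))
  have hQ0 : Q ≠ ⊥ := fun h ↦ hF (by simpa [h] using hQ.sup_eq_top)
  obtain ⟨V, hV, hVQ⟩ := (IsAtomic.eq_bot_or_exists_atom_le Q).resolve_left hQ0
  refine ⟨V, isSimpleModule_iff_isAtom.mpr hV, fun v hv ↦ Subtype.ext ?_⟩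
  have h1 : (v : MonoidAlgebra k G) ∈ F := fun n hn ↦ congrArg Subtype.val (hv n hn)
  have h2 := hQ.inf_eq_bot.le ⟨h1, hVQ v.2⟩
  simpa using h2

/-- For a simple module `V` without `N`-invariants, `k[G]` surjects onto `k[G/N] × End V`. -/
theorem mapDomain_prod_lsmul_surjective {k G : Type*} [Field k] [IsAlgClosed k] [CharZero k]
    [Group G] [Finite G] (N : Subgroup G) [N.Normal] (V : Type*) [AddCommGroup V] [Module k V]
    [Module (MonoidAlgebra k G) V] [IsScalarTower k (MonoidAlgebra k G) V]
    [IsSimpleModule (MonoidAlgebra k G) V] [FiniteDimensional k V]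
    (hinv : ∀ v : V, (∀ n ∈ N, MonoidAlgebra.of k G n • v = v) → v = 0) :
    Function.Surjective ((MonoidAlgebra.mapDomainAlgHom k k (QuotientGroup.mk' N)).prod
      (Algebra.lsmul k k V : MonoidAlgebra k G →ₐ[k] End k V)) := by
  cases nonempty_fintype N
  have h0 : (Fintype.card N : k) ≠ 0 := Nat.cast_ne_zero.mpr Fintype.card_ne_zero
  set α := MonoidAlgebra.mapDomainAlgHom k k (QuotientGroup.mk' N) with hα
  set β : MonoidAlgebra k G →ₐ[k] End k V := Algebra.lsmul k k V with hβ
  have hαof : ∀ g, α (MonoidAlgebra.of k G g) = MonoidAlgebra.of k (G ⧸ N) g := fun g ↦ by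
    simp [hα]
  have hαs : Function.Surjective α := by
    intro b
    induction b using MonoidAlgebra.induction_on with
    | of q =>
      obtain ⟨g, rfl⟩ := QuotientGroup.mk_surjective q
      exact ⟨_, hαof g⟩
    | add a b ha hb =>
      obtain ⟨a, rfl⟩ := ha
      obtain ⟨b, rfl⟩ := hb
      exact ⟨a + b, map_add _ _ _⟩
    | smul r a ha =>
      obtain ⟨a, rfl⟩ := ha
      exact ⟨r • a, map_smul _ _ _⟩
  have hβs : Function.Surjective β := lsmul_surjective_of_isSimpleModule k _ V
  let e : MonoidAlgebra k G := (Fintype.card N : k)⁻¹ • ∑ n : N, MonoidAlgebra.of k G n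
  have hαe : α e = 1 := by
    have h1 : ∀ n : N, α (MonoidAlgebra.of k G n) = 1 := fun n ↦ by
      rw [hαof, (QuotientGroup.eq_one_iff _).mpr n.2, map_one]
    simp only [e, map_smul, map_sum, h1, Finset.sum_const, Finset.card_univ,
      ← Nat.cast_smul_eq_nsmul k, smul_smul]
    rw [inv_mul_cancel₀ h0, one_smul]
  have hβe : β e = 0 := by
    ext v
    refine hinv _ fun n hn ↦ ?_
    change MonoidAlgebra.of k G n • e • v = e • v
    rw [smul_smul]
    congr 1
    rw [mul_smul_comm, Finset.mul_sum]
    congr 1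
    simp_rw [← map_mul]
    exact Equiv.sum_comp (Equiv.mulLeft (⟨n, hn⟩ : N)) fun m ↦ MonoidAlgebra.of k G (m : G)
  rintro ⟨b, T⟩
  obtain ⟨a₁, rfl⟩ := hαs b
  obtain ⟨a₂, rfl⟩ := hβs T
  -- The averaging element `e` maps to `(1, 0)`, which separates the two factors.
  refine ⟨e * a₁ + (1 - e) * a₂, Prod.ext ?_ ?_⟩
  · simp [hαe]
  · simp [hβe]

/-! ### Lower bound and conclusion -/

/-- The dimension of a simple module without `N`-invariants is bounded below. -/
theorem mul_pow_le_finrank {G : Type*} [Group G] [Finite G] (p k m : ℕ) (hp : p.Prime)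
    (hk : 0 < k) (hG : Nat.card G = p ^ (k + 2 * m) * (p ^ k - 1))
    (N : Subgroup G) [N.Normal] (hN : N.IsElementaryAbelian p) (hNcard : Nat.card N = p ^ k)
    (x : G) (hxN : x ∈ N) (hx : x ≠ 1)
    (C : Subgroup G) (hC : C = Subgroup.centralizer {x})
    (hCcard : Nat.card C = p ^ (k + 2 * m))
    (hcomm : ∀ H : Subgroup G, N ≤ H → H ≤ C → p ^ (k + m) < Nat.card H → N ≤ ⁅H, H⁆)
    (V : Type*) [AddCommGroup V] [Module ℂ V] [FiniteDimensional ℂ V] [Nontrivial V]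
    (ρ : G →* End ℂ V) (hinv : ∀ v : V, (∀ n ∈ N, ρ n v = v) → v = 0) :
    (p ^ k - 1) * p ^ m ≤ finrank ℂ V := by
  have : Fact p.Prime := ⟨hp⟩
  have hCp : IsPGroup p C := IsPGroup.of_card hCcard
  have : Group.IsNilpotent C := hCp.isNilpotent
  have hNC : N ≤ C := fun n hn ↦ by
    rw [hC, Subgroup.mem_centralizer_singleton_iff]
    exact hN.1 n hn x hxN
  obtain ⟨χ, hχ1, hχ⟩ := exists_ne_one_forall_conj_eq N C hN.1
    (hNcard ▸ dvd_pow_self p hk.ne') hCp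
  have hidx : Nat.card N - 1 ≤ (Subgroup.centralizer {x}).index := by
    have h1 := C.card_mul_index
    rw [hCcard, hG] at h1
    rw [hNcard, ← hC, Nat.eq_of_mul_eq_mul_left (pow_pos hp.pos _) h1]
  have htr : ∀ n : N, n ≠ 1 → LinearMap.trace ℂ V (ρ n) = LinearMap.trace ℂ V (ρ x) := by
    intro n hn
    obtain ⟨g, hg⟩ := exists_conj_eq N hxN hx hidx n.2 (by simpa using hn)
    rw [← hg, map_mul, LinearMap.trace_mul_comm, ← map_mul]
    congr 2
    group
  have hdim := finrank_eq_of_trace_eq (ρ.comp N.subtype) χ _ htr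
    (fun v hv ↦ hinv v fun n hn ↦ hv ⟨n, hn⟩) hχ1
  set W := weightSpace (ρ.comp N.subtype) χ with hW
  have hstab : ∀ c ∈ C, ∀ w ∈ W, ρ c w ∈ W := by
    intro c hc w hw n
    have h1 := hw (MulAut.conjNormal c⁻¹ n)
    rw [hχ _ (C.inv_mem hc)] at h1
    rw [← map_smul, ← h1]
    simp only [MonoidHom.comp_apply, Subgroup.subtype_apply, MulAut.conjNormal_apply]
    rw [← End.mul_apply, ← End.mul_apply, ← map_mul, ← map_mul]
    congr 2
    group
  let σ : C →* End ℂ W :=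
    { toFun := fun c ↦ (ρ c).restrict (hstab c c.2)
      map_one' := by ext; simp
      map_mul' := by intros; ext; simp }
  have hσ : ∀ (c : C) (w : W), (σ c w : V) = ρ c w := fun _ _ ↦ rfl
  have hWpos : 0 < finrank ℂ W := by
    have := finrank_pos (R := ℂ) (M := V)
    rw [hdim] at this
    exact Nat.pos_of_mul_pos_left this
  have : Nontrivial W := Module.nontrivial_of_finrank_pos hWpos
  have hσN : ∀ n : N, σ ⟨n, hNC n.2⟩ = (χ n : ℂ) • 1 := fun n ↦ by
    ext w
    simpa [hσ] using w.2 n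
  have hbound := card_le_mul_finrank_of_scalar N C hNC (p ^ (k + m)) hcomm σ
    (fun n hn ↦ ⟨_, hσN ⟨n, hn⟩⟩) (by
      by_contra! hall
      refine hχ1 (MonoidHom.ext fun n ↦ Units.ext ?_)
      obtain ⟨w, hw⟩ := exists_ne (0 : W)
      have h1 := hσN n
      rw [hall _ n.2] at h1
      have h2 := LinearMap.congr_fun h1 w
      rw [End.one_apply, LinearMap.smul_apply, End.one_apply] at h2
      have h3 : ((χ n : ℂ) - 1) • w = 0 := by rw [sub_smul, ← h2, one_smul, sub_self]
      exact sub_eq_zero.mp ((smul_eq_zero.mp h3).resolve_right hw))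
  rw [hCcard, show k + 2 * m = (k + m) + m by ring, pow_add _ (k + m)] at hbound
  rw [hdim, hNcard]
  exact Nat.mul_le_mul_left _ (Nat.le_of_mul_le_mul_left hbound (pow_pos hp.pos _))

theorem mainTheorem4 {G : Type*} [Group G] [Finite G] (p k m : ℕ) (hp : p.Prime) (hk : 0 < k)
    (hG : Nat.card G = p ^ (k + 2 * m) * (p ^ k - 1))
    (N : Subgroup G) [N.Normal] (hN : N.IsElementaryAbelian p) (hNcard : Nat.card N = p ^ k)
    (x : G) (hxN : x ∈ N) (hx : x ≠ 1)
    (C : Subgroup G) (hC : C = Subgroup.centralizer {x})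
    (hSylow : ∃ P : Sylow p G, (P : Subgroup G) = C)
    (hCcard : Nat.card C = p ^ (k + 2 * m))
    (hcomm : ∀ H : Subgroup G, N ≤ H → H ≤ C → p ^ (k + m) < Nat.card H → N ≤ ⁅H, H⁆) :
    ∃ (V : Type) (_ : AddCommGroup V) (_ : Module ℂ V) (_ : Module (MonoidAlgebra ℂ G) V)
      (_ : IsScalarTower ℂ (MonoidAlgebra ℂ G) V),
      IsSimpleModule (MonoidAlgebra ℂ G) V ∧
      Module.finrank ℂ V = (p ^ k - 1) * p ^ m ∧
      ∃ Φ : MonoidAlgebra ℂ G ≃ₐ[ℂ] MonoidAlgebra ℂ (G ⧸ N) × Module.End ℂ V,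
        ∀ a : MonoidAlgebra ℂ G,
          Φ a = (MonoidAlgebra.mapDomainAlgHom ℂ ℂ (QuotientGroup.mk' N) a,
            Algebra.lsmul ℂ ℂ V a) := by
  have hfin : ∀ H : Type _, [Finite H] → FiniteDimensional ℂ (MonoidAlgebra ℂ H) := fun H _ ↦
    Module.Finite.equiv (MonoidAlgebra.coeffLinearEquiv ℂ).symm
  have := hfin G
  have := hfin (G ⧸ N)
  have hNbot : N ≠ ⊥ := fun h ↦ hx (by simpa [h] using hxN)
  obtain ⟨V₀, hV₀, hinv₀⟩ := exists_isSimpleModule_forall_invariant_eq_zero ℂ N hNbot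
  have : FiniteDimensional ℂ V₀ := inferInstanceAs
    (FiniteDimensional ℂ (V₀.restrictScalars ℂ))
  -- `V₀` lives in the universe of `G`; finite dimension over `ℂ` lets it be moved to `Type`.
  have : Small.{0} V₀ := ⟨_, ⟨(finBasis ℂ V₀).equivFun.toEquiv⟩⟩
  let V := Shrink.{0} V₀
  let ε : V ≃ₗ[MonoidAlgebra ℂ G] V₀ := Shrink.linearEquiv _ _
  let ε' : V ≃ₗ[ℂ] V₀ := Shrink.linearEquiv _ _
  have : IsScalarTower ℂ (MonoidAlgebra ℂ G) V := ⟨fun c a v ↦ ε.injective <| by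
    rw [map_smul, smul_assoc]
    change _ = ε' (c • a • v)
    rw [map_smul]
    change c • a • ε v = c • ε (a • v)
    rw [map_smul]⟩
  have : IsSimpleModule (MonoidAlgebra ℂ G) V := IsSimpleModule.congr ε
  have : FiniteDimensional ℂ V := Module.Finite.equiv ε'.symm
  have hinv : ∀ v : V, (∀ n ∈ N, MonoidAlgebra.of ℂ G n • v = v) → v = 0 := fun v hv ↦
    ε.injective <| by
      rw [map_zero]
      exact hinv₀ _ fun n hn ↦ by rw [← map_smul, hv n hn]
  have : Nontrivial V := IsSimpleModule.nontrivial (MonoidAlgebra ℂ G) V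
  have hle := mul_pow_le_finrank p k m hp hk hG N hN hNcard x hxN hx C hC hCcard hcomm V
    (groupAction ℂ G V) hinv
  have hsurj := mapDomain_prod_lsmul_surjective N V hinv
  have hcardQ : Nat.card (G ⧸ N) = p ^ (2 * m) * (p ^ k - 1) := by
    have h1 := N.card_mul_index
    rw [hNcard, hG, pow_add, mul_assoc] at h1
    exact Nat.eq_of_mul_eq_mul_left (pow_pos hp.pos _) h1
  have hprod : finrank ℂ (MonoidAlgebra ℂ (G ⧸ N) × End ℂ V) =
      p ^ (2 * m) * (p ^ k - 1) + finrank ℂ V * finrank ℂ V := by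
    rw [finrank_prod, finrank_monoidAlgebra, hcardQ, finrank_linearMap]
  -- With `p^k = q + 1`, this is `p^(2m) (q + 1) q = p^(2m) q + (q p^m)²`.
  have hdimG : finrank ℂ (MonoidAlgebra ℂ G) = p ^ (2 * m) * (p ^ k - 1) +
      ((p ^ k - 1) * p ^ m) * ((p ^ k - 1) * p ^ m) := by
    rw [finrank_monoidAlgebra, hG]
    obtain ⟨q, hq⟩ : ∃ q, p ^ k = q + 1 := Nat.exists_eq_succ_of_ne_zero (pow_pos hp.pos _).ne'
    rw [pow_add, hq, Nat.add_sub_cancel]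
    ring
  let φ := (MonoidAlgebra.mapDomainAlgHom ℂ ℂ (QuotientGroup.mk' N)).prod
    (Algebra.lsmul ℂ ℂ V : MonoidAlgebra ℂ G →ₐ[ℂ] End ℂ V)
  have hge : finrank ℂ V ≤ (p ^ k - 1) * p ^ m := by
    have h1 := LinearMap.finrank_le_finrank_of_surjective (f := φ.toLinearMap) hsurj
    rw [hprod, hdimG] at h1
    exact Nat.mul_self_le_mul_self_iff.mp (by omega)
  have hdim := hge.antisymm hle
  have heq : finrank ℂ (MonoidAlgebra ℂ G) = finrank ℂ (MonoidAlgebra ℂ (G ⧸ N) × End ℂ V) := by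
    rw [hprod, hdimG, hdim]
  have hinj : Function.Injective φ.toLinearMap :=
    (LinearMap.injective_iff_surjective_of_finrank_eq_finrank (V := MonoidAlgebra ℂ G)
      (V₂ := MonoidAlgebra ℂ (G ⧸ N) × End ℂ V) heq (f := φ.toLinearMap)).mpr hsurj
  exact ⟨V, inferInstance, inferInstance, inferInstance, ‹_›, ‹_›, hdim,
    AlgEquiv.ofBijective φ ⟨hinj, hsurj⟩, fun _ ↦ rfl⟩
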